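/- **Model.** Fix integers $L,J\ge 0$ and $K\ge 1$, $0<\rho\le 1$, $N_0,W>0$, received powers $P_j>0$ ($1\le j\le J$), error probabilities $0<P_{e,l}<1$ and alphabet sizes $M_l\ge 1$ ($1\le l\le L$). A message of class $(l,j)$ has service requirement $S_l=-\ln P_{e,l}+\rho\ln M_l$ and received power $P_j$. For $s=(s_{lj})\in\mathbb Z_+^{LJ}$ let $$\phi_j(s)=\rho\ln\Bigl(1+\frac{P_j}{(1+\rho)\,(N_0W+\sum_{l',j'}s_{l'j'}P_{j'}-P_j)}\Bigr)\ \text{ if }\ \sum_l s_{lj}>0,\qquad \phi_j(s)=0\ \text{ otherwise};$$ this is the service quantum that a message of received power $P_j$ gets in a slot in which exactly $s_{l'j'}$ messages of each class $(l',j')$ transmit. Let $\mathcal S_K=\{s:\sum_{l,j}s_{lj}\le K\}$ be the set of schedules, and for $x,q>0$ let $\lceil x\rceil_q=q\cdot\min\{n\ge 1: x\le nq\}$. The numbers $A_{lj}$ of messages of class $(l,j)$ arriving in a slot are independent over classes and i.i.d. over slots, with finite second moments. A state-independent policy consists of a probability measure $p$ on $\mathcal S_K$ and, for each class $(l,j)$,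 a probability measure on $\{s\in\mathcal S_K:s_{lj}>0\}$, by which each arriving message of class $(l,j)$ is independently assigned a schedule $s$. The subclasses are the triples $(l,j,s)$ for which $s$ is assigned to messages of class $(l,j)$ with positive probability (so $s_{lj}>0$). Let $A_{ljs}$ be the number of messages of subclass $(l,j,s)$ that arrive in a slot. The state $\alpha$ at the start of a slot is the finite vector of the messages present, each given as $(x,l,j,z)$: residual requirement $x$, class $(l,j)$, assigned schedule $z$, with $(l,j,z)$ a subclass and $x>0$ one of the countably many values that can arise from $S_l$ by successive decrements $\phi_j(s')$, $s'\le z$, $s'_{lj}>0$. In each slot a schedule $s$ is drawn from $p$ independently of the state and the past. For each $(l,j)$, exactly $\min(n_{ljs}(\alpha),s_{lj})$ of the $n_{ljs}(\alpha)$ present messages of subclass $(l,j,s)$ transmit; which ones is decided by an arbitrary fixed selection rule (possibly randomized and dependent on $\alpha$ and $s$). If $s'$ counts the transmitting messages by class, each transmitting message of received power $P_j$ has its residual requirement reduced by $\phi_j(s')$ and leaves when it becomes $\le 0$. The new arrivals of the slot, with residual requirement $S_l$ for class $(l,j)$, then join. This defines a Markov chain $\{X_n\}$ on the countable set of states. **Theorem.**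 Suppose that for every subclass $(l,j,s)$ $$\mathbb E A_{ljs}<p(s)\,\frac{s_{lj}\,\phi_j(s)}{\lceil S_l\rceil_{\phi_j(s)}}.$$ Then the chain $\{X_n\}$ is positive recurrent. It has a stationary distribution, and under every stationary distribution the mean number of messages of each subclass is finite. Here, since the chain need not be irreducible, positive recurrent means: there is a finite set of states, each with finite mean return time, that is reached in finite mean time from every initial state. When some state $\alpha^*$ is accessible from every state (for instance the empty state, if $\Pr(A_{lj}=0)>0$ for all $l,j$), this says that $\alpha^*$ is reached in finite mean time from every initial state, $\alpha^*$ itself included. -/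

import Mathlib

open scoped ENNReal

noncomputable section

/-! ### Discrete-time Markov chains with a transition law `P : X → PMF X` -/

namespace MarkovChain

variable {X : Type*}

open Classical in
/-- `P_x(X₁ ∉ F, …, X_n ∉ F)`, the probability that the first return time
`τ_F = min {n ≥ 1 : X_n ∈ F}` of the chain started at `X₀ = x` exceeds `n`. -/
def avoidProb (P : X → PMF X) (F : Set X) : ℕ → X → ℝ≥0∞
  | 0, _ => 1
  | n + 1, x => ∑' y, P x y * (if y ∈ F then 0 else avoidProb P F n y)

/-- `E_x[τ_F] = ∑ₙ P_x(τ_F > n)`, with `τ_F = min {n ≥ 1 : X_n ∈ F}`. -/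
def meanReturnTime (P : X → PMF X) (F : Set X) (x : X) : ℝ≥0∞ :=
  ∑' n, avoidProb P F n x

/-- A state is positive recurrent if its mean return time is finite. -/
def IsPositiveRecurrentState (P : X → PMF X) (x : X) : Prop :=
  meanReturnTime P {x} x ≠ ⊤

/-- Positive recurrence of a chain that need not be irreducible: there is a finite set of positive
recurrent states which the chain reaches in finite mean time from every initial state. If some
state `x` is accessible from every state (in particular, if the chain is irreducible), this says
that `x` is reached in finite mean time from every initial state, `x` itself included. -/
def IsPositiveRecurrent (P : X → PMF X) : Prop :=
  ∃ F : Set X, F.Finite ∧ (∀ x ∈ F, IsPositiveRecurrentState P x) ∧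
    ∀ x, meanReturnTime P F x ≠ ⊤

/-- `π` is a stationary distribution. -/
def IsStationary (P : X → PMF X) (π : PMF X) : Prop := π.bind P = π

end MarkovChain

/-! ### The multiaccess model -/

namespace Multiaccess

/-- `E₀(ρ, P, σ²) = ρ ln (1 + P / ((1 + ρ) σ²))`. -/
def exponentE0 (ρ P σ2 : ℝ) : ℝ := ρ * Real.log (1 + P / ((1 + ρ) * σ2))

/-- `⌈x⌉_q = min {n ≥ 1 : x ≤ n q} · q`, for `x, q > 0`. -/
def ceilMul (x q : ℝ) : ℝ := (sInf {n : ℕ | 1 ≤ n ∧ x ≤ n * q} : ℕ) * q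

/-- The physical parameters: `L` service requirement classes and `J` received power classes. -/
structure Model (L J : ℕ) where
  /-- the parameter of the random coding bound -/
  ρ : ℝ
  ρ_pos : 0 < ρ
  ρ_le_one : ρ ≤ 1
  /-- the noise power spectral density -/
  N₀ : ℝ
  N₀_pos : 0 < N₀
  /-- the bandwidth -/
  W : ℝ
  W_pos : 0 < W
  /-- the received power of each power class -/
  P : Fin J → ℝ
  P_pos : ∀ j, 0 < P j
  /-- the tolerable decoding error probability of each requirement class -/
  Pe : Fin L → ℝ
  Pe_pos : ∀ l, 0 < Pe l
  Pe_lt_one : ∀ l, Pe l < 1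
  /-- the message alphabet size of each requirement class -/
  M : Fin L → ℕ
  M_pos : ∀ l, 1 ≤ M l

variable {L J K : ℕ}

/-- The service requirement `S_l = - ln P_{e,l} + ρ ln M_l`. -/
def Model.requirement (m : Model L J) (l : Fin L) : ℝ :=
  -Real.log (m.Pe l) + m.ρ * Real.log (m.M l)

/-- The service quantum `φ_j(s)` that each message of power class `j` receives in a slot in which
exactly `s l i` messages of each class `(l, i)` transmit; it is `0` if none has power class `j`. -/
def Model.quantum (m : Model L J) (s : Fin L → Fin J → ℕ) (j : Fin J) : ℝ :=
  if 0 < ∑ l, s l j then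
    exponentE0 m.ρ (m.P j) (m.N₀ * m.W + (∑ l, ∑ i, (s l i : ℝ) * m.P i) - m.P j)
  else 0

/-- The schedules with at most `K` transmissions. -/
abbrev Schedule (L J K : ℕ) : Type :=
  {s : Fin L → Fin J → ℕ // ∑ l, ∑ j, s l j ≤ K}

/-- A state-independent policy: the law `p` of the schedule of a slot, and for each class `(l, j)`
the law by which arriving messages of that class are assigned a schedule `s` with `s_{lj} > 0`. -/
structure Policy (L J K : ℕ) where
  p : PMF (Schedule L J K)
  assign : ∀ (l : Fin L) (j : Fin J), PMF {s : Schedule L J K // 0 < s.1 l j}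

/-- The values that the residual requirement of a message of class `(l, j)` with assigned schedule
`z` can take: initially it is `S_l`, and in a slot in which a part `s ≤ z` of the schedule, with
the message in it, is transmitted, it decreases by `φ_j(s)`. -/
inductive Attainable (m : Model L J) (l : Fin L) (j : Fin J) (z : Fin L → Fin J → ℕ) : ℝ → Prop
  | fresh : Attainable m l j z (m.requirement l)
  | serve {x : ℝ} (s : Fin L → Fin J → ℕ) (hx : Attainable m l j z x)
      (hs : ∀ l' j', s l' j' ≤ z l' j') (hpos : 0 < s l j) (hres : 0 < x - m.quantum s j) :
      Attainable m l j z (x - m.quantum s j)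

/-- A message `(x, l, j, z)` in the system. The subclasses are the triples `(l, j, z)` for which
`z` is assigned to messages of class `(l, j)` with positive probability. -/
structure Message (m : Model L J) (ω : Policy L J K) where
  /-- the residual service requirement -/
  x : ℝ
  l : Fin L
  j : Fin J
  z : {s : Schedule L J K // 0 < s.1 l j}
  subclass : ω.assign l j z ≠ 0
  attainable : Attainable m l j z.1.1 x

/-- The states of the chain: finite vectors of messages. -/
abbrev State (m : Model L J) (ω : Policy L J K) : Type := List (Message m ω)

variable {m : Model L J} {ω : Policy L J K}

/-- `n_{ljs}(α)`, the number of messages of subclass `(l, j, s)` in `α`. -/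
def count (α : State m ω) (l : Fin L) (j : Fin J) (s : Schedule L J K) : ℕ :=
  α.countP fun a => decide (a.l = l ∧ a.j = j ∧ a.z.1 = s)

/-- The number of messages of class `(l, j)` among the messages of `α` at the positions in `T`. -/
def transmitted (α : State m ω) (T : Finset (Fin α.length)) (l : Fin L) (j : Fin J) : ℕ :=
  (T.filter fun k => (α.get k).l = l ∧ (α.get k).j = j).card

/-- Transmission of the messages at the positions in `T` implements the schedule `s` in state `α`:
all of them were assigned `s`, and there are `min (n_{ljs}(α), s_{lj})` of subclass `(l, j, s)`. -/
def Implements (α : State m ω) (s : Schedule L J K) (T : Finset (Fin α.length)) : Prop :=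
  (∀ k ∈ T, (α.get k).z.1 = s) ∧ ∀ l j, transmitted α T l j = min (count α l j s) (s.1 l j)

/-- A rule, possibly randomized and state-dependent, that selects which messages of each subclass
transmit when a schedule is to be implemented. -/
abbrev SelectionRule (m : Model L J) (ω : Policy L J K) : Type :=
  ∀ (α : State m ω) (s : Schedule L J K), PMF {T : Finset (Fin α.length) // Implements α s T}

lemma attainable_serve {α : State m ω} {s : Schedule L J K} {T : Finset (Fin α.length)}
    (hT : Implements α s T) {k : Fin α.length} (hk : k ∈ T)
    (hx : 0 < (α.get k).x - m.quantum (transmitted α T) (α.get k).j) :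
    Attainable m (α.get k).l (α.get k).j (α.get k).z.1.1
      ((α.get k).x - m.quantum (transmitted α T) (α.get k).j) := by
  refine Attainable.serve _ (α.get k).attainable (fun l j => ?_) ?_ hx
  · rw [hT.1 k hk, hT.2 l j]
    exact min_le_right _ _
  · exact Finset.card_pos.2 ⟨k, by simp [hk]⟩

/-- The messages left of `α`, in their order, after a slot in which those at the positions in `T`
transmit: each of these is served the quantum that goes with the actual set of transmissions, and
departs when its requirement is met. -/
def survivors (α : State m ω) (s : Schedule L J K)
    (T : {T : Finset (Fin α.length) // Implements α s T}) : State m ω :=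
  (List.finRange α.length).filterMap fun k =>
    if hk : k ∈ T.1 then
      if hx : 0 < (α.get k).x - m.quantum (transmitted α T.1) (α.get k).j then
        some { α.get k with
          x := (α.get k).x - m.quantum (transmitted α T.1) (α.get k).j
          attainable := attainable_serve T.2 hk hx }
      else none
    else some (α.get k)

/-- The law of a list of `n` independent samples from `μ`. -/
def iidList {β : Type*} (μ : PMF β) : ℕ → PMF (List β)
  | 0 => PMF.pure []
  | n + 1 => μ.bind fun b => (iidList μ n).map fun bs => b :: bs

/-- The law of an arriving message of class `(l, j)`: its schedule is random, its residual service
requirement is `S_l`. -/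
def freshLaw (m : Model L J) (ω : Policy L J K) (l : Fin L) (j : Fin J) : PMF (Message m ω) :=
  (ω.assign l j).bindOnSupport fun z hz =>
    PMF.pure ⟨m.requirement l, l, j, z, hz, Attainable.fresh⟩

/-- The law of the messages of the classes in a list that arrive in a slot: the numbers of messages
of the various classes are independent, with laws `A l j`. -/
def batchLaw (m : Model L J) (ω : Policy L J K) (A : Fin L → Fin J → PMF ℕ) :
    List (Fin L × Fin J) → PMF (State m ω)
  | [] => PMF.pure []
  | c :: cs => (A c.1 c.2).bind fun n => (iidList (freshLaw m ω c.1 c.2) n).bind fun b =>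
      (batchLaw m ω A cs).map fun bs => b ++ bs

/-- The law of the batch of messages of all classes that arrives in a slot. -/
def arrivals (m : Model L J) (ω : Policy L J K) (A : Fin L → Fin J → PMF ℕ) : PMF (State m ω) :=
  batchLaw m ω A (List.product (List.finRange L) (List.finRange J))

/-- `E A_{ljs}`, the mean number of messages of subclass `(l, j, s)` that arrive in a slot. -/
def meanArrivals (m : Model L J) (ω : Policy L J K) (A : Fin L → Fin J → PMF ℕ)
    (l : Fin L) (j : Fin J) (s : Schedule L J K) : ℝ≥0∞ :=
  ∑' b : State m ω, arrivals m ω A b * (count b l j s : ℝ≥0∞)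

/-- The transition law of the chain: in a slot, a schedule is drawn from `p` independently of the
state, the selected messages of the subclasses of that schedule are served, and at the end of the
slot an independent batch of messages arrives. -/
def step (A : Fin L → Fin J → PMF ℕ) (rule : SelectionRule m ω) (α : State m ω) :
    PMF (State m ω) :=
  ω.p.bind fun s => (rule α s).bind fun T =>
    (arrivals m ω A).map fun b => survivors α s T ++ b

end Multiaccess

end

noncomputable section

/-! ### Expectations of nonnegative functions under a `PMF` -/

namespace PMF

variable {β γ : Type*}

/-- The expectation of a nonnegative function. -/
def ev (p : PMF β) (g : β → ℝ≥0∞) : ℝ≥0∞ := ∑' a, p a * g a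

lemma ev_mono (p : PMF β) {g h : β → ℝ≥0∞} (H : ∀ a, g a ≤ h a) : p.ev g ≤ p.ev h :=
  ENNReal.tsum_le_tsum fun a => mul_le_mul_right (H a) _

lemma ev_add (p : PMF β) (g h : β → ℝ≥0∞) : p.ev (fun a => g a + h a) = p.ev g + p.ev h := by
  simp only [ev, mul_add, ENNReal.tsum_add]

lemma ev_const_mul (p : PMF β) (c : ℝ≥0∞) (g : β → ℝ≥0∞) :
    p.ev (fun a => c * g a) = c * p.ev g := by
  simp only [ev, ← ENNReal.tsum_mul_left]
  exact tsum_congr fun a => by ring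

lemma ev_const (p : PMF β) (c : ℝ≥0∞) : p.ev (fun _ => c) = c := by
  simp [ev, ENNReal.tsum_mul_right, p.tsum_coe]

lemma ev_sum {ι : Type*} (p : PMF β) (s : Finset ι) (g : ι → β → ℝ≥0∞) :
    p.ev (fun a => ∑ i ∈ s, g i a) = ∑ i ∈ s, p.ev (g i) := by
  simp only [ev, Finset.mul_sum]
  exact Summable.tsum_finsetSum fun _ _ => ENNReal.summable

lemma ev_pure (a : β) (g : β → ℝ≥0∞) : (PMF.pure a).ev g = g a := by
  rw [ev, tsum_eq_single a]
  · simp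
  · intro b hb
    simp [hb]

lemma ev_bind (p : PMF β) (q : β → PMF γ) (g : γ → ℝ≥0∞) :
    (p.bind q).ev g = p.ev fun a => (q a).ev g := by
  simp only [ev, PMF.bind_apply, ← ENNReal.tsum_mul_left, ← ENNReal.tsum_mul_right]
  rw [ENNReal.tsum_comm]
  exact tsum_congr fun a => tsum_congr fun b => by ring

lemma ev_map (p : PMF β) (f : β → γ) (g : γ → ℝ≥0∞) : (p.map f).ev g = p.ev fun a => g (f a) := by
  rw [← PMF.bind_pure_comp, ev_bind]
  simp [ev_pure]

end PMF

namespace MarkovChain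

variable {X : Type*}

open Classical in
lemma meanReturnTime_eq (P : X → PMF X) (F : Set X) (x : X) :
    meanReturnTime P F x =
      1 + (P x).ev fun y => if y ∈ F then 0 else meanReturnTime P F y := by
  rw [meanReturnTime, tsum_eq_zero_add' ENNReal.summable]
  simp only [avoidProb, PMF.ev]
  rw [ENNReal.tsum_comm]
  congr 1
  refine tsum_congr fun y => ?_
  rw [ENNReal.tsum_mul_left]
  split_ifs <;> simp [meanReturnTime]

open Classical in
/-- The mean return time is the least solution of the first step inequality. -/
lemma meanReturnTime_le (P : X → PMF X) (F : Set X) (g : X → ℝ≥0∞)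
    (hg : ∀ x, 1 + (P x).ev (fun y => if y ∈ F then 0 else g y) ≤ g x) (x : X) :
    meanReturnTime P F x ≤ g x := by
  have key : ∀ n x, ∑ i ∈ Finset.range n, avoidProb P F i x ≤ g x := by
    intro n
    induction n with
    | zero => simp
    | succ n ih =>
      intro x
      refine le_trans ?_ (hg x)
      rw [Finset.sum_range_succ', add_comm]
      simp only [avoidProb]
      gcongr
      change ∑ i ∈ Finset.range n, (P x).ev _ ≤ _
      rw [← PMF.ev_sum]
      refine PMF.ev_mono _ fun y => ?_
      split_ifs
      · simp
      · exact ih y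
  rw [meanReturnTime, ENNReal.tsum_eq_iSup_nat]
  exact iSup_le fun n => key n x

lemma meanReturnTime_empty (P : X → PMF X) (x : X) : meanReturnTime P ∅ x = ⊤ := by
  have h : ∀ n x, avoidProb P ∅ n x = 1 := by
    intro n
    induction n with
    | zero => intro x; rfl
    | succ n ih => intro x; simp [avoidProb, ih, PMF.tsum_coe]
  simp [meanReturnTime, h]

open Classical in
/-- The first step operator of the probability that the first visit to `F` is at `x`. -/
def entranceStep (P : X → PMF X) (F : Set X) (x : X) : (X → ℝ≥0∞) →o (X → ℝ≥0∞) where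
  toFun u w := (P w).ev fun y => if y = x then 1 else if y ∈ F then 0 else u y
  monotone' u v huv w := PMF.ev_mono _ fun y => by
    split_ifs
    exacts [le_rfl, le_rfl, huv y]

/-- The probability that the first visit to `F` is at `x`. -/
def entranceProb (P : X → PMF X) (F : Set X) (x : X) : X → ℝ≥0∞ := (entranceStep P F x).lfp

open Classical in
lemma entranceProb_eq (P : X → PMF X) (F : Set X) (x w : X) :
    entranceProb P F x w =
      (P w).ev fun y => if y = x then 1 else if y ∈ F then 0 else entranceProb P F x y :=
  (congrFun (entranceStep P F x).map_lfp w).symm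

lemma entranceProb_le_one (P : X → PMF X) (F : Set X) (x w : X) : entranceProb P F x w ≤ 1 := by
  refine (entranceStep P F x).lfp_le (a := fun _ => 1) (fun w => ?_) w
  refine (PMF.ev_mono (P w) (h := fun _ => 1) fun y => ?_).trans (PMF.ev_const _ _).le
  split_ifs <;> simp

lemma meanReturnTime_diff_singleton_ne_top {P : X → PMF X} {F : Set X}
    (hF : ∀ w, meanReturnTime P F w ≠ ⊤) {x : X} (hx : x ∈ F) (hu : entranceProb P F x x < 1)
    (w : X) : meanReturnTime P (F \ {x}) w ≠ ⊤ := by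
  classical
  set h := meanReturnTime P F with hh
  set u := entranceProb P F x with hu'
  set c : ℝ≥0∞ := h x / (1 - u x) with hc
  have hpos : 1 - u x ≠ 0 := (tsub_pos_of_lt hu).ne'
  have hctop : c ≠ ⊤ := ENNReal.div_ne_top (hF x) hpos
  have hcx : h x + c * u x = c := by
    have h1 : c * (1 - u x) = h x :=
      ENNReal.div_mul_cancel hpos (ne_top_of_le_ne_top ENNReal.one_ne_top tsub_le_self)
    rw [← h1, ← mul_add, tsub_add_cancel_of_le hu.le, mul_one]
  refine ne_top_of_le_ne_top (b := h w + c * u w) ?_ ?_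
  · exact ENNReal.add_ne_top.2 ⟨hF w, ENNReal.mul_ne_top hctop
      (ne_top_of_le_ne_top ENNReal.one_ne_top (entranceProb_le_one P F x w))⟩
  refine meanReturnTime_le P (F \ {x}) (fun w => h w + c * u w) (fun w => ?_) w
  rw [hh, meanReturnTime_eq, ← hh, hu', entranceProb_eq, ← hu', add_assoc, ← PMF.ev_const_mul,
    ← PMF.ev_add]
  gcongr
  refine PMF.ev_mono _ fun y => ?_
  by_cases hyx : y = x
  · subst hyx
    simp [hcx, hx]
  · by_cases hyF : y ∈ F <;> simp [hyx, hyF]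

lemma isPositiveRecurrentState_of_entranceProb {P : X → PMF X} {F : Set X} {x : X}
    (hF : meanReturnTime P F x ≠ ⊤) (hu : 1 ≤ entranceProb P F x x) :
    IsPositiveRecurrentState P x := by
  classical
  have hux := le_antisymm (entranceProb_le_one P F x x) hu
  refine ne_top_of_le_ne_top hF ?_
  have := meanReturnTime_le P {x}
    (fun w => if entranceProb P F x w = 1 then meanReturnTime P F w else ⊤) (fun w => ?_) x
  · simpa [hux] using this
  by_cases hw : entranceProb P F x w = 1
  swap
  · simp [hw]
  simp only [hw, if_true]
  rw [meanReturnTime_eq]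
  refine add_le_add le_rfl (ENNReal.tsum_le_tsum fun y => ?_)
  by_cases hPy : P w y = 0
  · simp [hPy]
  by_cases hyx : y = x
  · simp [hyx]
  set v : X → ℝ≥0∞ := fun y => if y = x then 1 else if y ∈ F then 0 else entranceProb P F x y
  have hv : ∀ y, v y ≤ 1 := fun y => by
    simp only [v]
    split_ifs
    exacts [le_rfl, zero_le_one, entranceProb_le_one P F x y]
  have hsum : (∑' y, P w y * (1 - v y)) = 0 := by
    have h1 : (P w).ev v = 1 := by rw [← hw, entranceProb_eq]
    have h2 : (P w).ev (fun y => 1 - v y) + (P w).ev v = 1 := by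
      rw [← PMF.ev_add]
      simp only [tsub_add_cancel_of_le (hv _), PMF.ev_const]
    rw [h1] at h2
    exact ENNReal.add_right_inj (ENNReal.one_ne_top) |>.1
      ((add_comm _ _).trans (h2.trans (add_zero 1).symm))
  have hvy : v y = 1 := by
    have := ENNReal.tsum_eq_zero.1 hsum y
    rcases mul_eq_zero.1 this with h | h
    · exact absurd h hPy
    · exact le_antisymm (hv y) (tsub_eq_zero_iff_le.1 h)
  by_cases hyF : y ∈ F
  · simp [v, hyx, hyF] at hvy
  · simp only [v, hyx, hyF, if_false] at hvy
    simp [hyx, hyF, hvy]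

/-- If a finite set is reached in finite mean time from everywhere, then so is a finite set of
positive recurrent states. -/
theorem isPositiveRecurrent_of_finite {P : X → PMF X} {F : Set X} (hfin : F.Finite)
    (hF : ∀ w, meanReturnTime P F w ≠ ⊤) : IsPositiveRecurrent P := by
  induction hn : F.ncard using Nat.strong_induction_on generalizing F with
  | _ n ih =>
    by_cases h : ∀ x ∈ F, 1 ≤ entranceProb P F x x
    · exact ⟨F, hfin, fun x hx => isPositiveRecurrentState_of_entranceProb (hF x) (h x hx), hF⟩
    · push Not at h
      obtain ⟨x, hx, hu⟩ := h
      exact ih _ (hn ▸ Set.ncard_sdiff_singleton_lt_of_mem hx hfin) (hfin.subset Set.sdiff_subset)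
        (meanReturnTime_diff_singleton_ne_top hF hx hu) rfl

/-! ### Existence of stationary distributions -/

open Classical in
/-- `P_x(X_n = y, τ_x > n)`, where `τ_x` is the first return time to `x`. -/
def tabooProb (P : X → PMF X) (x : X) : ℕ → X → ℝ≥0∞
  | 0, y => if y = x then 1 else 0
  | n + 1, y => if y = x then 0 else ∑' w, tabooProb P x n w * P w y

lemma tsum_tabooProb (P : X → PMF X) (x : X) (n : ℕ) :
    ∑' y, tabooProb P x n y = avoidProb P {x} n x := by
  classical
  have key : ∀ n k, ∑' y, tabooProb P x n y * avoidProb P {x} k y = avoidProb P {x} (n + k) x := by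
    intro n
    induction n with
    | zero =>
      intro k
      rw [tsum_eq_single x]
      · simp [tabooProb]
      · intro y hy
        simp [tabooProb, hy]
    | succ n ih =>
      intro k
      rw [show n + 1 + k = n + (k + 1) by ring, ← ih (k + 1)]
      simp only [avoidProb, ← ENNReal.tsum_mul_left]
      rw [ENNReal.tsum_comm]
      refine tsum_congr fun y => ?_
      by_cases hy : y = x
      · simp [tabooProb, hy]
      · simp only [tabooProb, hy, if_false, Set.mem_singleton_iff, ← ENNReal.tsum_mul_right]
        exact tsum_congr fun w => by ring
  simpa [avoidProb] using key n 0

theorem exists_isStationary_of_isPositiveRecurrentState {P : X → PMF X} {x : X}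
    (hx : IsPositiveRecurrentState P x) : ∃ π : PMF X, IsStationary P π := by
  classical
  set ν : X → ℝ≥0∞ := fun y => ∑' n, tabooProb P x n y with hν
  have hmass : ∑' y, ν y = meanReturnTime P {x} x := by
    rw [hν, ENNReal.tsum_comm]
    exact tsum_congr fun n => tsum_tabooProb P x n
  have hfin : ∑' y, ν y ≠ ⊤ := hmass ▸ hx
  have hpos : ∑' y, ν y ≠ 0 := by
    rw [hmass, meanReturnTime_eq]
    simp
  have hne : ∀ y, y ≠ x → ∑' w, ν w * P w y = ν y := by
    intro y hy
    simp only [hν, ← ENNReal.tsum_mul_right]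
    rw [ENNReal.tsum_comm, tsum_eq_zero_add' (f := fun n => tabooProb P x n y) ENNReal.summable]
    simp [tabooProb, hy]
  have htot : ∑' y, ∑' w, ν w * P w y = ∑' y, ν y := by
    rw [ENNReal.tsum_comm]
    exact tsum_congr fun w => by rw [ENNReal.tsum_mul_left, (P w).tsum_coe, mul_one]
  have hxx : ∑' w, ν w * P w x = ν x := by
    have h2 : ∑' y, (if y = x then 0 else ∑' w, ν w * P w y) = ∑' y, if y = x then 0 else ν y :=
      tsum_congr fun y => by
        split_ifs with hy
        exacts [rfl, hne y hy]
    rw [ENNReal.tsum_eq_add_tsum_ite x, ENNReal.tsum_eq_add_tsum_ite (f := ν) x, h2] at htot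
    refine (ENNReal.add_left_inj (ne_top_of_le_ne_top hfin (ENNReal.tsum_le_tsum fun y => ?_))).1
      htot
    split_ifs <;> simp
  have hinv : ∀ y, ∑' w, ν w * P w y = ν y := fun y => by
    by_cases hy : y = x
    exacts [hy ▸ hxx, hne y hy]
  refine ⟨PMF.normalize ν hpos hfin, PMF.ext fun y => ?_⟩
  simp only [PMF.bind_apply, PMF.normalize_apply]
  rw [← hinv y, ← ENNReal.tsum_mul_right]
  exact tsum_congr fun w => by ring

theorem IsPositiveRecurrent.exists_isStationary [Nonempty X] {P : X → PMF X}
    (h : IsPositiveRecurrent P) : ∃ π : PMF X, IsStationary P π := by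
  obtain ⟨F, -, hF, hmean⟩ := h
  obtain ⟨x, hx⟩ : F.Nonempty := by
    by_contra hne
    rw [Set.not_nonempty_iff_eq_empty] at hne
    subst hne
    exact hmean (Classical.arbitrary X) (meanReturnTime_empty P _)
  exact exists_isStationary_of_isPositiveRecurrentState (hF x hx)

/-! ### The Foster–Lyapunov criterion -/

/-- If `E_x V(X₁) + f(x) ≤ V(x) + C` with a finite `V` and an `f` with finite sublevel sets, then
the chain is positive recurrent. -/
theorem isPositiveRecurrent_of_drift {P : X → PMF X} {V f : X → ℝ≥0∞} {C : ℝ≥0∞}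
    (hV : ∀ x, V x ≠ ⊤) (hC : C ≠ ⊤) (hdrift : ∀ x, (P x).ev V + f x ≤ V x + C)
    (hf : {x | f x ≤ C + 1}.Finite) : IsPositiveRecurrent P := by
  classical
  refine isPositiveRecurrent_of_finite hf fun w => ?_
  set F := {x | f x ≤ C + 1}
  refine ne_top_of_le_ne_top (b := V w + C + 1)
    (ENNReal.add_ne_top.2 ⟨ENNReal.add_ne_top.2 ⟨hV w, hC⟩, ENNReal.one_ne_top⟩) ?_
  refine (meanReturnTime_le P F (fun y => if y ∈ F then V y + C + 1 else V y) (fun x => ?_) w).trans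
    ?_
  · refine (add_le_add le_rfl (PMF.ev_mono _ (h := V) fun y => ?_)).trans ?_
    · split_ifs <;> simp
    split_ifs with hx
    · rw [add_comm]
      exact add_le_add (le_self_add.trans (hdrift x)) le_rfl
    · have hx' : C + 1 ≤ f x := (not_le.1 hx).le
      have h := (add_le_add_right hx' ((P x).ev V)).trans (hdrift x)
      rw [add_comm C, ← add_assoc, add_comm _ (1 : ℝ≥0∞)] at h
      exact (ENNReal.add_le_add_iff_right hC).1 h
  · split_ifs
    · exact le_rfl
    · rw [add_assoc]
      exact le_self_add

/-- Under `E_x V(X₁) + f(x) ≤ V(x) + C`, every stationary distribution has `∫ f ≤ C`. -/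
theorem IsStationary.ev_le_of_drift {P : X → PMF X} {π : PMF X} (hπ : IsStationary P π)
    {V f : X → ℝ≥0∞} {C : ℝ≥0∞} (hV : ∀ x, V x ≠ ⊤)
    (hdrift : ∀ x, (P x).ev V + f x ≤ V x + C) : π.ev f ≤ C := by
  classical
  have htrunc : ∀ M : ℝ≥0∞, M ≠ ⊤ → π.ev (fun x => if V x ≤ M then f x else 0) ≤ C := by
    intro M hM
    set g : X → ℝ≥0∞ := fun x => min (V x) M with hg
    have hgM : π.ev g ≠ ⊤ := ne_top_of_le_ne_top hM
      ((PMF.ev_mono π fun x => min_le_right _ _).trans (PMF.ev_const π M).le)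
    have hstat : π.ev (fun x => (P x).ev g) = π.ev g := by
      rw [← PMF.ev_bind, hπ]
    have hpt : ∀ x, (P x).ev g + (if V x ≤ M then f x else 0) ≤ g x + C := by
      intro x
      split_ifs with hx
      · rw [hg]
        simp only [min_eq_left hx]
        exact (add_le_add (PMF.ev_mono _ fun y => min_le_left _ _) le_rfl).trans (hdrift x)
      · rw [hg]
        simp only [min_eq_right (not_le.1 hx).le, add_zero]
        exact ((PMF.ev_mono _ fun y => min_le_right _ _).trans (PMF.ev_const _ M).le).trans
          le_self_add
    have h := PMF.ev_mono π hpt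
    rw [PMF.ev_add, PMF.ev_add, hstat, PMF.ev_const] at h
    exact (ENNReal.add_le_add_iff_left hgM).1 h
  rw [PMF.ev, ENNReal.tsum_eq_iSup_sum]
  refine iSup_le fun t => ?_
  refine le_trans ?_ (htrunc (∑ x ∈ t, V x) (ENNReal.sum_ne_top.2 fun x _ => hV x))
  refine le_trans (Finset.sum_le_sum fun x hx => ?_) (ENNReal.sum_le_tsum t)
  simp only [if_pos (Finset.single_le_sum (f := V) (fun _ _ => zero_le) hx), le_rfl]

end MarkovChain

namespace Multiaccess

variable {L J K : ℕ}

/-! ### Numbers of rounds -/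

/-- `min {n ≥ 1 : x ≤ n q}`, so that `⌈x⌉_q = rounds x q * q`. -/
def rounds (x q : ℝ) : ℕ := sInf {n : ℕ | 1 ≤ n ∧ x ≤ n * q}

lemma rounds_mem {x q : ℝ} (hq : 0 < q) : 1 ≤ rounds x q ∧ x ≤ rounds x q * q := by
  refine Nat.sInf_mem (s := {n : ℕ | 1 ≤ n ∧ x ≤ n * q}) ?_
  obtain ⟨n, hn⟩ := Archimedean.arch x hq
  refine ⟨n + 1, by omega, ?_⟩
  rw [nsmul_eq_mul] at hn
  push_cast
  nlinarith

lemma rounds_le {x q : ℝ} {n : ℕ} (h1 : 1 ≤ n) (h : x ≤ n * q) : rounds x q ≤ n :=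
  Nat.sInf_le ⟨h1, h⟩

lemma rounds_mono {x y q : ℝ} (hq : 0 < q) (h : x ≤ y) : rounds x q ≤ rounds y q :=
  rounds_le (rounds_mem hq).1 (h.trans (rounds_mem hq).2)

lemma rounds_sub_add_one_le {x q r : ℝ} (hq : 0 < q) (hr : q ≤ r) (hx : 0 < x - r) :
    rounds (x - r) q + 1 ≤ rounds x q := by
  obtain ⟨h1, h2⟩ := rounds_mem (x := x) hq
  obtain ⟨n, hn⟩ : ∃ n, rounds x q = n + 1 := ⟨rounds x q - 1, by omega⟩
  rw [hn] at h2 ⊢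
  push_cast at h2
  have hn1 : 1 ≤ n := by
    by_contra h
    have : n = 0 := by omega
    subst this
    norm_num at h2
    linarith
  exact Nat.succ_le_succ (rounds_le hn1 (by linarith))

/-! ### Service quanta and residual requirements -/

lemma Model.requirement_pos (m : Model L J) (l : Fin L) : 0 < m.requirement l := by
  have h1 := Real.log_neg (m.Pe_pos l) (m.Pe_lt_one l)
  have h2 : 0 ≤ Real.log (m.M l) := Real.log_natCast_nonneg _
  have h3 := mul_nonneg m.ρ_pos.le h2
  unfold Model.requirement
  linarith

lemma Model.interference_pos (m : Model L J) {s : Fin L → Fin J → ℕ} {j : Fin J}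
    (hs : 0 < ∑ l, s l j) :
    0 < m.N₀ * m.W + (∑ l, ∑ i, (s l i : ℝ) * m.P i) - m.P j := by
  obtain ⟨l, -, hl⟩ := Finset.exists_ne_zero_of_sum_ne_zero hs.ne'
  have hnn : ∀ l i, 0 ≤ (s l i : ℝ) * m.P i := fun l i =>
    mul_nonneg (Nat.cast_nonneg _) (m.P_pos i).le
  have h1 : (s l j : ℝ) * m.P j ≤ ∑ i, (s l i : ℝ) * m.P i :=
    Finset.single_le_sum (f := fun i => (s l i : ℝ) * m.P i) (fun i _ => hnn l i)
      (Finset.mem_univ j)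
  have h2 : ∑ i, (s l i : ℝ) * m.P i ≤ ∑ l, ∑ i, (s l i : ℝ) * m.P i :=
    Finset.single_le_sum (f := fun l => ∑ i, (s l i : ℝ) * m.P i)
      (fun l _ => Finset.sum_nonneg fun i _ => hnn l i) (Finset.mem_univ l)
  have h3 : m.P j ≤ (s l j : ℝ) * m.P j :=
    le_mul_of_one_le_left (m.P_pos j).le (by exact_mod_cast Nat.one_le_iff_ne_zero.2 hl)
  have h4 := mul_pos m.N₀_pos m.W_pos
  linarith

lemma Model.quantum_pos (m : Model L J) {s : Fin L → Fin J → ℕ} {j : Fin J}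
    (hs : 0 < ∑ l, s l j) : 0 < m.quantum s j := by
  rw [Model.quantum, if_pos hs, exponentE0]
  have h := m.interference_pos hs
  have hρ := m.ρ_pos
  refine mul_pos hρ (Real.log_pos ?_)
  have := div_pos (m.P_pos j) (mul_pos (by linarith : 0 < 1 + m.ρ) h)
  linarith

lemma Model.quantum_nonneg (m : Model L J) (s : Fin L → Fin J → ℕ) (j : Fin J) :
    0 ≤ m.quantum s j := by
  by_cases hs : 0 < ∑ l, s l j
  · exact (m.quantum_pos hs).le
  · simp [Model.quantum, hs]

/-- Partial transmission of a schedule gives larger service quanta. -/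
lemma Model.quantum_anti (m : Model L J) {s z : Fin L → Fin J → ℕ} {j : Fin J}
    (hs : 0 < ∑ l, s l j) (hsz : ∀ l i, s l i ≤ z l i) : m.quantum z j ≤ m.quantum s j := by
  have hz : 0 < ∑ l, z l j := hs.trans_le (Finset.sum_le_sum fun l _ => hsz l j)
  have h := m.interference_pos hs
  have h' := m.interference_pos hz
  have hρ := m.ρ_pos
  have hP := m.P_pos j
  have hle : (∑ l, ∑ i, (s l i : ℝ) * m.P i) ≤ ∑ l, ∑ i, (z l i : ℝ) * m.P i :=
    Finset.sum_le_sum fun l _ => Finset.sum_le_sum fun i _ =>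
      mul_le_mul_of_nonneg_right (by exact_mod_cast hsz l i) (m.P_pos i).le
  rw [Model.quantum, Model.quantum, if_pos hs, if_pos hz, exponentE0, exponentE0]
  refine mul_le_mul_of_nonneg_left (Real.log_le_log ?_ ?_) hρ.le
  · have := div_pos hP (mul_pos (by linarith : 0 < 1 + m.ρ) h')
    linarith
  · gcongr

lemma sum_pos_of_apply_pos {s : Fin L → Fin J → ℕ} {l : Fin L} {j : Fin J} (h : 0 < s l j) :
    0 < ∑ l, s l j :=
  h.trans_le (Finset.single_le_sum (f := fun l => s l j) (fun _ _ => Nat.zero_le _)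
    (Finset.mem_univ l))

variable {m : Model L J} {ω : Policy L J K}

lemma Attainable.pos {l : Fin L} {j : Fin J} {z : Fin L → Fin J → ℕ} {x : ℝ}
    (h : Attainable m l j z x) : 0 < x := by
  cases h with
  | fresh => exact m.requirement_pos l
  | serve s hx hs hpos hres => exact hres

lemma Attainable.le_requirement {l : Fin L} {j : Fin J} {z : Fin L → Fin J → ℕ} {x : ℝ}
    (h : Attainable m l j z x) : x ≤ m.requirement l := by
  induction h with
  | fresh => exact le_rfl
  | serve s hx hs hpos hres ih => linarith [m.quantum_nonneg s j]

lemma finite_attainable (m : Model L J) (l : Fin L) (j : Fin J) {z : Fin L → Fin J → ℕ}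
    (hz : 0 < z l j) : {x | Attainable m l j z x}.Finite := by
  have hq := m.quantum_pos (sum_pos_of_apply_pos hz)
  obtain ⟨N, hN⟩ := Archimedean.arch (m.requirement l) hq
  rw [nsmul_eq_mul] at hN
  have hfin : Finite (Set.Iic z) := Set.finite_Iic z
  refine ((List.finite_length_le (Set.Iic z) N).image fun t =>
    m.requirement l - (t.map fun s => m.quantum s.1 j).sum).subset ?_
  intro x hx
  have key : ∃ t : List (Set.Iic z), x = m.requirement l - (t.map fun s => m.quantum s.1 j).sum ∧
      t.length * m.quantum z j ≤ (t.map fun s => m.quantum s.1 j).sum := by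
    induction hx with
    | fresh => exact ⟨[], by simp, by simp⟩
    | serve s hx hs hpos hres ih =>
      obtain ⟨t, rfl, ht⟩ := ih
      refine ⟨⟨s, hs⟩ :: t, ?_, ?_⟩
      · simp only [List.map_cons, List.sum_cons]
        ring
      · have := m.quantum_anti (sum_pos_of_apply_pos hpos) hs
        simp only [List.map_cons, List.sum_cons, List.length_cons]
        push_cast
        linarith
  obtain ⟨t, hxt, ht⟩ := key
  refine ⟨t, ?_, hxt.symm⟩
  have h0 := Attainable.pos hx
  have : (t.length : ℝ) * m.quantum z j < N * m.quantum z j := by linarith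
  exact_mod_cast (lt_of_mul_lt_mul_right this hq.le).le

instance finite_schedule : Finite (Schedule L J K) := by
  refine Set.Finite.subset (Set.finite_Iic fun _ _ => K) fun s (hs : _ ≤ K) l j => ?_
  exact ((Finset.single_le_sum (f := fun j => s l j) (fun _ _ => Nat.zero_le _)
    (Finset.mem_univ j)).trans (Finset.single_le_sum (f := fun l => ∑ j, s l j)
      (fun _ _ => Nat.zero_le _) (Finset.mem_univ l))).trans hs

instance fintype_schedule : Fintype (Schedule L J K) := Fintype.ofFinite _

instance finite_message : Finite (Message m ω) := by
  have : ∀ l j (z : {s : Schedule L J K // 0 < s.1 l j}),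
      Finite {x | Attainable m l j z.1.1 x} := fun l j z => finite_attainable m l j z.2
  refine Finite.of_injective (β := Σ l j, Σ z : {s : Schedule L J K // 0 < s.1 l j},
    {x | Attainable m l j z.1.1 x}) (fun a => ⟨a.l, a.j, a.z, a.x, a.attainable⟩) ?_
  rintro ⟨x, l, j, z, h, h'⟩ ⟨x', l', j', z', k, k'⟩ he
  simp only [Sigma.mk.injEq] at he
  obtain ⟨rfl, he⟩ := he
  simp only [heq_eq_eq, Sigma.mk.injEq] at he
  obtain ⟨rfl, he⟩ := he
  simp only [heq_eq_eq, Sigma.mk.injEq] at he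
  obtain ⟨rfl, he⟩ := he
  simpa using he

/-! ### Workloads -/

/-- The number of slots of the assigned schedule that suffice to serve a message. -/
def Message.rounds (a : Message m ω) : ℕ := Multiaccess.rounds a.x (m.quantum a.z.1.1 a.j)

lemma Message.quantum_pos (a : Message m ω) : 0 < m.quantum a.z.1.1 a.j :=
  m.quantum_pos (sum_pos_of_apply_pos a.z.2)

lemma Message.one_le_rounds (a : Message m ω) : 1 ≤ a.rounds := (rounds_mem a.quantum_pos).1

/-- The contribution of a message to the workload of subclass `(l, j, s)`. -/
def Message.load (l : Fin L) (j : Fin J) (s : Schedule L J K) (a : Message m ω) : ℕ :=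
  if a.l = l ∧ a.j = j ∧ a.z.1 = s then a.rounds else 0

/-- The total number of rounds that the messages of subclass `(l, j, s)` still need. -/
def workload (l : Fin L) (j : Fin J) (s : Schedule L J K) (α : State m ω) : ℕ :=
  (α.map (Message.load l j s)).sum

lemma workload_append (l : Fin L) (j : Fin J) (s : Schedule L J K) (α β : State m ω) :
    workload l j s (α ++ β) = workload l j s α + workload l j s β := by
  simp [workload]

lemma workload_le (l : Fin L) (j : Fin J) (s : Schedule L J K) (α : State m ω) :
    workload l j s α ≤ rounds (m.requirement l) (m.quantum s.1 j) * count α l j s := by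
  induction α with
  | nil => simp [workload]
  | cons a α ih =>
    simp only [workload, List.map_cons, List.sum_cons, count, List.countP_cons] at ih ⊢
    rw [mul_add, add_comm]
    refine add_le_add ih ?_
    by_cases h : a.l = l ∧ a.j = j ∧ a.z.1 = s
    · simp only [Message.load, h, and_self, if_true, decide_true, mul_one, Message.rounds]
      obtain ⟨rfl, rfl, rfl⟩ := h
      exact rounds_mono a.quantum_pos a.attainable.le_requirement
    · simp [Message.load, h]

lemma length_le_sum_workload (α : State m ω) :
    α.length ≤ ∑ l, ∑ j, ∑ s, workload l j s α := by
  induction α with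
  | nil => simp
  | cons a α ih =>
    simp only [workload, List.map_cons, List.sum_cons, List.length_cons,
      Finset.sum_add_distrib] at ih ⊢
    rw [add_comm]
    refine add_le_add (a.one_le_rounds.trans ?_) ih
    calc a.rounds = Message.load a.l a.j a.z.1 a := by simp [Message.load]
      _ ≤ ∑ s, Message.load a.l a.j s a :=
        Finset.single_le_sum (f := fun s => Message.load a.l a.j s a) (fun _ _ => Nat.zero_le _)
          (Finset.mem_univ _)
      _ ≤ ∑ j, ∑ s, Message.load a.l j s a :=
        Finset.single_le_sum (f := fun j => ∑ s, Message.load a.l j s a)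
          (fun _ _ => Nat.zero_le _) (Finset.mem_univ _)
      _ ≤ _ :=
        Finset.single_le_sum (f := fun l => ∑ j, ∑ s, Message.load l j s a)
          (fun _ _ => Nat.zero_le _) (Finset.mem_univ _)

lemma sum_map_filterMap_finRange {β : Type*} (n : ℕ) (g : Fin n → Option β) (w : β → ℕ) :
    (((List.finRange n).filterMap g).map w).sum = ∑ k, ((g k).map w).getD 0 := by
  rw [← List.sum_ofFn, List.ofFn_eq_map]
  induction List.finRange n with
  | nil => rfl
  | cons a t ih =>
    cases h : g a <;> simp [h, ih]

/-- Transmission lowers the workload of each scheduled subclass by the number of messages of the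
subclass that transmit. -/
lemma workload_survivors_add_le (l : Fin L) (j : Fin J) (z : Schedule L J K) (α : State m ω)
    (s : Schedule L J K) (T : {T : Finset (Fin α.length) // Implements α s T}) :
    workload l j z (survivors α s T) + (if s = z then min (count α l j z) (z.1 l j) else 0) ≤
      workload l j z α := by
  have h1 : (if s = z then min (count α l j z) (z.1 l j) else 0) =
      ∑ k : Fin α.length,
        if s = z ∧ k ∈ T.1 ∧ (α.get k).l = l ∧ (α.get k).j = j then 1 else 0 := by
    split_ifs with hsz
    · subst hsz
      rw [← T.2.2 l j, transmitted, Finset.card_filter, ← Finset.sum_subset (Finset.subset_univ T.1)]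
      · exact Finset.sum_congr rfl fun k hk => by simp [hk]
      · intro k _ hk
        simp [hk]
    · simp [hsz]
  have h2 : workload l j z α = ∑ k : Fin α.length, Message.load l j z (α.get k) := by
    rw [workload, ← List.sum_ofFn, List.ofFn_eq_map]
    conv_lhs => rw [← List.map_get_finRange α, List.map_map]
    rfl
  rw [h1, h2, workload, survivors, sum_map_filterMap_finRange, ← Finset.sum_add_distrib]
  refine Finset.sum_le_sum fun k _ => ?_
  by_cases hk : k ∈ T.1
  swap
  · simp [hk]
  have hz : (α.get k).z.1 = s := T.2.1 k hk
  have hq : m.quantum (α.get k).z.1.1 (α.get k).j ≤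
      m.quantum (transmitted α T.1) (α.get k).j := by
    refine m.quantum_anti (sum_pos_of_apply_pos (l := (α.get k).l) ?_) fun l j => ?_
    · exact Finset.card_pos.2 ⟨k, by simp [hk]⟩
    · rw [T.2.2 l j, hz]
      exact min_le_right _ _
  have hone := (α.get k).one_le_rounds
  have hqp := (α.get k).quantum_pos
  rw [dif_pos hk]
  by_cases hx : 0 < (α.get k).x - m.quantum (transmitted α T.1) (α.get k).j
  · rw [dif_pos hx]
    have hr := rounds_sub_add_one_le hqp hq hx
    simp only [Option.map_some, Option.getD_some, Message.load, Message.rounds, hz] at hr ⊢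
    by_cases hc : (α.get k).l = l ∧ (α.get k).j = j ∧ s = z
    · rw [if_pos hc, if_pos hc, if_pos ⟨hc.2.2, hk, hc.1, hc.2.1⟩]
      exact hr
    · rw [if_neg hc, if_neg (fun h => hc ⟨h.2.2.1, h.2.2.2, h.1⟩)]
      exact Nat.zero_le _
  · rw [dif_neg hx]
    simp only [Option.map_none, Option.getD_none, zero_add, Message.load, hz]
    by_cases hc : (α.get k).l = l ∧ (α.get k).j = j ∧ s = z
    · rw [if_pos hc]
      split_ifs <;> omega
    · rw [if_neg hc, if_neg (fun h => hc ⟨h.2.2.1, h.2.2.2, h.1⟩)]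

/-! ### Moments of the arrivals -/

lemma ev_iidList_length {β : Type*} (μ : PMF β) (n : ℕ) (g : ℕ → ℝ≥0∞) :
    (iidList μ n).ev (fun t => g t.length) = g n := by
  induction n generalizing g with
  | zero => simp [iidList, PMF.ev_pure]
  | succ n ih =>
    simp only [iidList, PMF.ev_bind, PMF.ev_map, List.length_cons]
    simp only [ih fun k => g (k + 1), PMF.ev_const]

lemma ev_batchLaw_length_sq_ne_top {A : Fin L → Fin J → PMF ℕ}
    (hA : ∀ l j, ∑' k : ℕ, A l j k * (k : ℝ≥0∞) ^ 2 ≠ ⊤) (cs : List (Fin L × Fin J)) :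
    (batchLaw m ω A cs).ev (fun b => (b.length : ℝ≥0∞) ^ 2) ≠ ⊤ := by
  induction cs with
  | nil => simp [batchLaw, PMF.ev_pure]
  | cons c cs ih =>
    have hpt : ∀ n k : ℕ, ((n + k : ℕ) : ℝ≥0∞) ^ 2 ≤ 2 * (n : ℝ≥0∞) ^ 2 + 2 * (k : ℝ≥0∞) ^ 2 := by
      intro n k
      have : (n + k) ^ 2 ≤ 2 * n ^ 2 + 2 * k ^ 2 := by
        zify
        nlinarith [sq_nonneg ((n : ℤ) - k)]
      exact_mod_cast this
    refine ne_top_of_le_ne_top (b := 2 * (A c.1 c.2).ev (fun n => (n : ℝ≥0∞) ^ 2) +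
      2 * (batchLaw m ω A cs).ev (fun b => (b.length : ℝ≥0∞) ^ 2)) ?_ ?_
    · exact ENNReal.add_ne_top.2 ⟨ENNReal.mul_ne_top ENNReal.ofNat_ne_top (hA c.1 c.2),
        ENNReal.mul_ne_top ENNReal.ofNat_ne_top ih⟩
    · simp only [batchLaw, PMF.ev_bind, PMF.ev_map, List.length_append]
      set Q := (batchLaw m ω A cs).ev (fun b => (b.length : ℝ≥0∞) ^ 2)
      have hQ : ∀ n : ℕ, ((iidList (freshLaw m ω c.1 c.2) n).ev fun t =>
          (batchLaw m ω A cs).ev fun bs => ((t.length + bs.length : ℕ) : ℝ≥0∞) ^ 2) ≤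
            2 * (n : ℝ≥0∞) ^ 2 + 2 * Q := fun n => by
        rw [ev_iidList_length _ n fun i =>
          (batchLaw m ω A cs).ev fun bs => ((i + bs.length : ℕ) : ℝ≥0∞) ^ 2]
        have h := PMF.ev_mono (batchLaw m ω A cs)
          (h := fun bs => 2 * (n : ℝ≥0∞) ^ 2 + 2 * (bs.length : ℝ≥0∞) ^ 2)
          fun bs => hpt n bs.length
        rwa [PMF.ev_add, PMF.ev_const, PMF.ev_const_mul] at h
      refine (PMF.ev_mono _ hQ).trans ?_
      rw [PMF.ev_add, PMF.ev_const, PMF.ev_const_mul]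

lemma ev_arrivals_count_sq_ne_top {A : Fin L → Fin J → PMF ℕ}
    (hA : ∀ l j, ∑' k : ℕ, A l j k * (k : ℝ≥0∞) ^ 2 ≠ ⊤) (l : Fin L) (j : Fin J)
    (z : Schedule L J K) :
    (arrivals m ω A).ev (fun b => (count b l j z : ℝ≥0∞) ^ 2) ≠ ⊤ := by
  refine ne_top_of_le_ne_top (ev_batchLaw_length_sq_ne_top (m := m) (ω := ω) hA _)
    (PMF.ev_mono _ fun b => ?_)
  have : count b l j z ≤ b.length := List.countP_le_length
  gcongr

/-! ### The drift of the squared workloads -/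

lemma sq_add_two_mul_le {Y D U Z R n k : ℕ} (h : Y + D ≤ U) (hD : D ≤ k) (hZ : Z ≤ R * n) :
    (Y + Z) ^ 2 + 2 * U * D ≤ U ^ 2 + (k ^ 2 + R ^ 2 * n ^ 2) + 2 * U * (R * n) := by
  have h1 : (Y + Z) ^ 2 ≤ Y ^ 2 + 2 * U * (R * n) + R ^ 2 * n ^ 2 := by
    calc (Y + Z) ^ 2 ≤ (Y + R * n) ^ 2 := by gcongr
      _ = Y ^ 2 + 2 * Y * (R * n) + R ^ 2 * n ^ 2 := by ring
      _ ≤ _ := by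
        gcongr
        omega
  have h2 : Y ^ 2 + 2 * U * D ≤ U ^ 2 + D ^ 2 := by
    obtain ⟨e, rfl⟩ := Nat.exists_eq_add_of_le h
    nlinarith [Nat.zero_le (Y * e), Nat.zero_le (e ^ 2)]
  have h3 : D ^ 2 ≤ k ^ 2 := by gcongr
  omega

lemma ev_step_workload_sq_add_le (A : Fin L → Fin J → PMF ℕ) (rule : SelectionRule m ω)
    (l : Fin L) (j : Fin J) (z : Schedule L J K) (α : State m ω) :
    (step A rule α).ev (fun β => (workload l j z β : ℝ≥0∞) ^ 2) +
        2 * workload l j z α * (ω.p z * (min (count α l j z) (z.1 l j) : ℕ)) ≤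
      (workload l j z α : ℝ≥0∞) ^ 2 + ((z.1 l j : ℝ≥0∞) ^ 2 +
          (rounds (m.requirement l) (m.quantum z.1 j) : ℝ≥0∞) ^ 2 *
            (arrivals m ω A).ev (fun b => (count b l j z : ℝ≥0∞) ^ 2)) +
        2 * workload l j z α * (rounds (m.requirement l) (m.quantum z.1 j) *
          meanArrivals m ω A l j z) := by
  set U := workload l j z α with hU
  set R := rounds (m.requirement l) (m.quantum z.1 j) with hR
  set D : Schedule L J K → ℕ := fun s => if s = z then min (count α l j z) (z.1 l j) else 0 with hD
  have hp : ω.p z * (min (count α l j z) (z.1 l j) : ℕ) = ω.p.ev fun s => (D s : ℝ≥0∞) := by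
    rw [PMF.ev, tsum_eq_single z]
    · simp [hD]
    · intro s hs
      simp [hD, hs]
  have hmean : meanArrivals m ω A l j z =
    (arrivals m ω A).ev fun b => (count b l j z : ℝ≥0∞) := rfl
  rw [hp, hmean, ← PMF.ev_const_mul, step]
  simp only [PMF.ev_bind, PMF.ev_map]
  rw [← PMF.ev_add]
  refine (PMF.ev_mono _ fun s => ?_).trans (PMF.ev_const ω.p _).le
  rw [← PMF.ev_const (rule α s) (2 * (U : ℝ≥0∞) * D s), ← PMF.ev_add]
  refine (PMF.ev_mono _ fun T => ?_).trans (PMF.ev_const (rule α s) _).le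
  rw [← PMF.ev_const (arrivals m ω A) (2 * (U : ℝ≥0∞) * D s), ← PMF.ev_add,
    ← PMF.ev_const_mul, ← PMF.ev_const_mul, ← PMF.ev_const_mul,
    ← PMF.ev_const (arrivals m ω A) ((z.1 l j : ℝ≥0∞) ^ 2), ← PMF.ev_add,
    ← PMF.ev_const (arrivals m ω A) ((U : ℝ≥0∞) ^ 2), ← PMF.ev_add, ← PMF.ev_add]
  refine PMF.ev_mono _ fun b => ?_
  have h1 := workload_survivors_add_le l j z α s T
  have h2 := workload_le l j z b
  rw [workload_append]
  have h3 : D s ≤ z.1 l j := by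
    simp only [hD]
    split_ifs
    exacts [min_le_right _ _, Nat.zero_le _]
  exact_mod_cast sq_add_two_mul_le h1 h3 h2

lemma count_eq_zero {l : Fin L} {j : Fin J} {z : Schedule L J K}
    (h : ∀ hz : 0 < z.1 l j, ω.assign l j ⟨z, hz⟩ = 0) (α : State m ω) : count α l j z = 0 := by
  rw [count, List.countP_eq_zero]
  intro a _ ha
  simp only [decide_eq_true_eq] at ha
  obtain ⟨rfl, rfl, rfl⟩ := ha
  exact a.subclass (h a.z.2)

/-- The drift inequality for the squared workload of a subclass. -/
lemma exists_drift {A : Fin L → Fin J → PMF ℕ}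
    (hA : ∀ l j, ∑' k : ℕ, A l j k * (k : ℝ≥0∞) ^ 2 ≠ ⊤) (rule : SelectionRule m ω)
    (hload : ∀ (l : Fin L) (j : Fin J) (s : {s : Schedule L J K // 0 < s.1 l j}),
      ω.assign l j s ≠ 0 →
        meanArrivals m ω A l j s.1 <
          ENNReal.ofReal ((ω.p s.1).toReal *
            ((s.1.1 l j : ℝ) * m.quantum s.1.1 j /
              ceilMul (m.requirement l) (m.quantum s.1.1 j))))
    (l : Fin L) (j : Fin J) (z : Schedule L J K) :
    ∃ w C : ℝ≥0∞, w ≠ ⊤ ∧ C ≠ ⊤ ∧ ∀ α,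
      (step A rule α).ev (fun β => w * (workload l j z β : ℝ≥0∞) ^ 2) + workload l j z α ≤
        w * (workload l j z α : ℝ≥0∞) ^ 2 + C := by
  by_cases hsub : ∃ hz : 0 < z.1 l j, ω.assign l j ⟨z, hz⟩ ≠ 0
  swap
  · push Not at hsub
    refine ⟨0, 0, by simp, by simp, fun α => ?_⟩
    have := workload_le l j z α
    rw [count_eq_zero hsub, mul_zero, Nat.le_zero] at this
    simp [this, PMF.ev_const]
  obtain ⟨hz, hassign⟩ := hsub
  have hl := hload l j ⟨z, hz⟩ hassign
  have hq := m.quantum_pos (sum_pos_of_apply_pos hz)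
  set R := rounds (m.requirement l) (m.quantum z.1 j) with hR
  have hR1 : 1 ≤ R := (rounds_mem hq).1
  have hR0 : (0 : ℝ) < R := by exact_mod_cast hR1
  have hpz : ω.p z ≠ ⊤ := (ω.p).apply_ne_top z
  have hlt : (R : ℝ≥0∞) * meanArrivals m ω A l j z < ω.p z * (z.1 l j : ℕ) := by
    have h1 : (R : ℝ≥0∞) * ENNReal.ofReal ((ω.p z).toReal *
        ((z.1 l j : ℝ) * m.quantum z.1 j / ceilMul (m.requirement l) (m.quantum z.1 j))) =
          ω.p z * (z.1 l j : ℕ) := by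
      have h2 : (ω.p z).toReal *
          ((z.1 l j : ℝ) * m.quantum z.1 j / ceilMul (m.requirement l) (m.quantum z.1 j)) =
            (ω.p z).toReal * (z.1 l j : ℝ) / R := by
        change (ω.p z).toReal * ((z.1 l j : ℝ) * m.quantum z.1 j / (R * m.quantum z.1 j)) = _
        field_simp
      rw [h2, ← ENNReal.ofReal_natCast R, ← ENNReal.ofReal_mul hR0.le, mul_div_cancel₀ _ hR0.ne',
        ENNReal.ofReal_mul ENNReal.toReal_nonneg, ENNReal.ofReal_toReal hpz,
        ENNReal.ofReal_natCast]
    rw [← h1]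
    exact ENNReal.mul_lt_mul_right (by exact_mod_cast hR0.ne') (ENNReal.natCast_ne_top R) hl
  set a := (R : ℝ≥0∞) * meanArrivals m ω A l j z with ha
  set S := ω.p z * (z.1 l j : ℕ) with hS
  have hStop : S ≠ ⊤ := ENNReal.mul_ne_top hpz (ENNReal.natCast_ne_top _)
  have hatop : a ≠ ⊤ := hlt.ne_top
  obtain ⟨ε, hε0, hεtop, hε⟩ : ∃ ε : ℝ≥0∞, ε ≠ 0 ∧ ε ≠ ⊤ ∧ a + ε = S :=
    ⟨S - a, (tsub_pos_of_lt hlt).ne', ne_top_of_le_ne_top hStop tsub_le_self,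
      add_tsub_cancel_of_le hlt.le⟩
  set B := (z.1 l j : ℝ≥0∞) ^ 2 +
    (R : ℝ≥0∞) ^ 2 * (arrivals m ω A).ev (fun b => (count b l j z : ℝ≥0∞) ^ 2) with hB
  have hBtop : B ≠ ⊤ := ENNReal.add_ne_top.2 ⟨by finiteness,
    ENNReal.mul_ne_top (by finiteness) (ev_arrivals_count_sq_ne_top hA l j z)⟩
  have h2ε0 : 2 * ε ≠ 0 := mul_ne_zero two_ne_zero hε0
  have h2εtop : 2 * ε ≠ ⊤ := ENNReal.mul_ne_top ENNReal.ofNat_ne_top hεtop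
  set C := B + 2 * ((R * z.1 l j : ℕ) : ℝ≥0∞) * S with hC
  have hCtop : C ≠ ⊤ := ENNReal.add_ne_top.2 ⟨hBtop, ENNReal.mul_ne_top (by finiteness) hStop⟩
  have hw : (2 * ε)⁻¹ ≠ ⊤ := ENNReal.inv_ne_top.2 h2ε0
  refine ⟨(2 * ε)⁻¹, (2 * ε)⁻¹ * C, hw, ENNReal.mul_ne_top hw hCtop, fun α => ?_⟩
  have hcore := ev_step_workload_sq_add_le A rule l j z α
  have hUle := workload_le l j z α
  rw [← hR, ← ha, ← hB] at hcore
  rw [← hR] at hUle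
  set U := workload l j z α with hU
  have key : (step A rule α).ev (fun β => (workload l j z β : ℝ≥0∞) ^ 2) + 2 * ε * U ≤
      (U : ℝ≥0∞) ^ 2 + C := by
    rcases le_total (z.1 l j) (count α l j z) with h | h
    · rw [min_eq_right h, ← hS, ← hε] at hcore
      have hfin : 2 * (U : ℝ≥0∞) * a ≠ ⊤ := ENNReal.mul_ne_top (by finiteness) hatop
      have h1 : (step A rule α).ev (fun β => (workload l j z β : ℝ≥0∞) ^ 2) + 2 * ε * U ≤
          (U : ℝ≥0∞) ^ 2 + B := by
        refine (ENNReal.add_le_add_iff_right hfin).1 (le_trans (le_of_eq ?_) hcore)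
        ring
      exact h1.trans (add_le_add le_rfl le_self_add)
    · have hUR : (U : ℝ≥0∞) ≤ ((R * z.1 l j : ℕ) : ℝ≥0∞) := by
        exact_mod_cast hUle.trans (Nat.mul_le_mul_left R h)
      calc (step A rule α).ev (fun β => (workload l j z β : ℝ≥0∞) ^ 2) + 2 * ε * U
          ≤ (U : ℝ≥0∞) ^ 2 + B + 2 * U * a + 2 * ε * U :=
            add_le_add (le_self_add.trans hcore) le_rfl
        _ = (U : ℝ≥0∞) ^ 2 + (B + 2 * U * S) := by rw [← hε]; ring
        _ ≤ _ := by
          rw [hC]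
          gcongr
  rw [PMF.ev_const_mul]
  calc _ = (2 * ε)⁻¹ * ((step A rule α).ev (fun β => (workload l j z β : ℝ≥0∞) ^ 2) + 2 * ε * U) := by
        rw [mul_add, ← mul_assoc _ (2 * ε), ENNReal.inv_mul_cancel h2ε0 h2εtop, one_mul]
    _ ≤ _ := by
        rw [← mul_add]
        gcongr

end Multiaccess

end

open Multiaccess MarkovChain in
theorem mainTheorem5 {L J K : ℕ} (hK : 1 ≤ K) (m : Model L J)
    (A : Fin L → Fin J → PMF ℕ)
    (hA : ∀ l j, ∑' k : ℕ, A l j k * (k : ℝ≥0∞) ^ 2 ≠ ⊤)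
    (ω : Policy L J K) (rule : SelectionRule m ω)
    (hload : ∀ (l : Fin L) (j : Fin J) (s : {s : Schedule L J K // 0 < s.1 l j}),
      ω.assign l j s ≠ 0 →
        meanArrivals m ω A l j s.1 <
          ENNReal.ofReal ((ω.p s.1).toReal *
            ((s.1.1 l j : ℝ) * m.quantum s.1.1 j /
              ceilMul (m.requirement l) (m.quantum s.1.1 j)))) :
    IsPositiveRecurrent (step A rule) ∧
      (∃ π : PMF (State m ω), IsStationary (step A rule) π) ∧
      ∀ π : PMF (State m ω), IsStationary (step A rule) π →
        ∀ (l : Fin L) (j : Fin J) (s : Schedule L J K),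
          ∑' α : State m ω, π α * (count α l j s : ℝ≥0∞) ≠ ⊤ := by
  choose w C hw hC hdrift using exists_drift hA rule hload
  set V : State m ω → ℝ≥0∞ := fun α => ∑ l, ∑ j, ∑ s, w l j s * (workload l j s α : ℝ≥0∞) ^ 2
  set f : State m ω → ℝ≥0∞ := fun α => ∑ l, ∑ j, ∑ s, (workload l j s α : ℝ≥0∞)
  set B : ℝ≥0∞ := ∑ l, ∑ j, ∑ s, C l j s
  have hB : B ≠ ⊤ := ENNReal.sum_ne_top.2 fun l _ => ENNReal.sum_ne_top.2 fun j _ =>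
    ENNReal.sum_ne_top.2 fun s _ => hC l j s
  have hV : ∀ α, V α ≠ ⊤ := fun α => ENNReal.sum_ne_top.2 fun l _ => ENNReal.sum_ne_top.2 fun j _ =>
    ENNReal.sum_ne_top.2 fun s _ =>
      ENNReal.mul_ne_top (hw l j s) (ENNReal.pow_ne_top (ENNReal.natCast_ne_top _))
  have hVf : ∀ α, (step A rule α).ev V + f α ≤ V α + B := by
    intro α
    simp only [V, f, B, PMF.ev_sum, ← Finset.sum_add_distrib]
    exact Finset.sum_le_sum fun l _ => Finset.sum_le_sum fun j _ => Finset.sum_le_sum fun s _ =>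
      hdrift l j s α
  have hlen : ∀ α : State m ω, (α.length : ℝ≥0∞) ≤ f α := fun α => by
    simp only [f]
    exact_mod_cast length_le_sum_workload α
  have hfin : {α | f α ≤ B + 1}.Finite := by
    obtain ⟨N, hN⟩ := ENNReal.exists_nat_gt (ENNReal.add_ne_top.2 ⟨hB, ENNReal.one_ne_top⟩)
    refine (List.finite_length_le (Message m ω) N).subset fun α hα => ?_
    exact_mod_cast ((hlen α).trans hα).trans hN.le
  have hrec := isPositiveRecurrent_of_drift hV hB hVf hfin
  refine ⟨hrec, hrec.exists_isStationary, fun π hπ l j s => ?_⟩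
  refine ne_top_of_le_ne_top hB (le_trans (PMF.ev_mono π fun α => ?_) (hπ.ev_le_of_drift hV hVf))
  refine le_trans ?_ (hlen α)
  exact_mod_cast List.countP_le_length
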